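/- **Setting.** For $p\in\mathbb R^3$ put $p^0=\sqrt{1+|p|^2}$. For $p,q\in\mathbb R^3$ let $s=(p^0+q^0)^2-|p+q|^2$, $g=\sqrt{|p-q|^2-(p^0-q^0)^2}$, $v_{\mathrm M}=\dfrac{g\sqrt s}{p^0q^0}$, $\gamma=\dfrac{p^0+q^0}{\sqrt s}$, and for $\omega\in\mathbb S^2$ $$p'=\tfrac{p+q}{2}+\tfrac g2\Big(\omega+(\gamma-1)(p+q)\tfrac{(p+q)\cdot\omega}{|p+q|^2}\Big),\qquad q'=\tfrac{p+q}{2}-\tfrac g2\Big(\omega+(\gamma-1)(p+q)\tfrac{(p+q)\cdot\omega}{|p+q|^2}\Big)$$ (the term with $\gamma-1$ is read as $0$ if $p+q=0$). The scattering angle $\theta\in[0,\pi]$ is given by $$\cos\theta=\frac{-(p^0-q^0)(p'^0-q'^0)+(p-q)\cdot(p'-q')}{g^2}\qquad(p\ne q).$$ Let $\Lambda\ge1$ and let the measurable scattering kernel $\sigma(g,\theta)$ satisfy $\Lambda^{-1}g\,\sigma_0(\theta)\le\sigma(g,\theta)\le\Lambda\, g\,\sigma_0(\theta)$ for $g\ge0$,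 $\theta\in[0,\pi]$, where $\sigma_0$ is measurable with $0\le\sigma_0\le\frac1{4\pi}$. For measurable $f:[0,1]\times\mathbb R^3\to[0,\infty)$ define $$Q^+(f,f)(x_1,p)=\int_{\mathbb R^3}\int_{\mathbb S^2}v_{\mathrm M}\,\sigma(g,\theta)\,f(x_1,p')\,f(x_1,q')\,d\omega\,dq\in[0,\infty],$$ where $d\omega$ is the surface measure on $\mathbb S^2$. For $k>0$ let $\varphi(p)=e^{kp^0}$, let $\|h(\cdot,p)\|_{L^\infty_{x_1}}=\operatorname{ess\,sup}_{x_1\in[0,1]}|h(x_1,p)|$, and let $$\|f\|=\int_{\mathbb R^3}\|f(\cdot,p)\|_{L^\infty_{x_1}}\,(p^0)^{1/2}\,\varphi(p)\,dp\in[0,\infty].$$ **Proposition.** There is a constant $C>0$, depending only on $\Lambda$, such that for all $\sigma,\sigma_0$ as above, all $k>0$, all measurable $f:[0,1]\times\mathbb R^3\to[0,\infty)$ and all $a\in\mathbb R^3$, $$\int_{\mathbb R^3}\frac{\varphi(p)}{|p-a|}\,\big\|Q^+(f,f)(\cdot,p)\big\|_{L^\infty_{x_1}}\,dp\;\le\;C\,\|f\|^2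 .$$ -/

import Mathlib

open MeasureTheory

noncomputable section

namespace RelBoltzmann

/-- Momentum space `ℝ³` with the Euclidean norm. -/
abbrev Momentum : Type := EuclideanSpace ℝ (Fin 3)

/-- The unit sphere `𝕊²` of scattering directions. -/
abbrev S2 : Type := Metric.sphere (0 : Momentum) 1

/-- The surface measure `dω` on `𝕊²` (total mass `4π`). -/
def surfaceMeasure : Measure S2 := (volume : Measure Momentum).toSphere

/-- The energy `p⁰ = √(1 + |p|²)`, with `c = m = 1`. -/
def energy (p : Momentum) : ℝ := Real.sqrt (1 + ‖p‖ ^ 2)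

/-- Lorentz product `-t t' + v · v'` of the four-vectors `(t, v)` and `(t', v')`. -/
def lorentz (t : ℝ) (v : Momentum) (t' : ℝ) (v' : Momentum) : ℝ :=
  -(t * t') + inner ℝ v v'

/-- `s = -(p^μ + q^μ)(p_μ + q_μ)`, the square of the energy in the center-of-momentum frame. -/
def sInv (p q : Momentum) : ℝ :=
  -lorentz (energy p + energy q) (p + q) (energy p + energy q) (p + q)

/-- The relative momentum `g = √((p^μ - q^μ)(p_μ - q_μ))`. -/
def relMom (p q : Momentum) : ℝ :=
  Real.sqrt (lorentz (energy p - energy q) (p - q) (energy p - energy q) (p - q))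

/-- The Møller velocity `g √s / (p⁰ q⁰)`. -/
def moller (p q : Momentum) : ℝ :=
  relMom p q * Real.sqrt (sInv p q) / (energy p * energy q)

/-- `γ = (p⁰ + q⁰) / √s`. -/
def gammaCM (p q : Momentum) : ℝ := (energy p + energy q) / Real.sqrt (sInv p q)

/-- `ω + (γ - 1)(p + q) ((p + q) · ω) / |p + q|²`, which is `ω` when `p + q = 0`. -/
def cmDir (p q : Momentum) (ω : S2) : Momentum :=
  (ω : Momentum) +
    ((gammaCM p q - 1) * (inner ℝ (p + q) (ω : Momentum) / ‖p + q‖ ^ 2)) • (p + q)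

/-- The post-collisional momentum `p'`. -/
def postP (p q : Momentum) (ω : S2) : Momentum :=
  (1 / 2 : ℝ) • (p + q) + (relMom p q / 2) • cmDir p q ω

/-- The post-collisional momentum `q'`. -/
def postQ (p q : Momentum) (ω : S2) : Momentum :=
  (1 / 2 : ℝ) • (p + q) - (relMom p q / 2) • cmDir p q ω

/-- The scattering angle `θ ∈ [0, π]`, `cos θ = (p^μ - q^μ)(p'_μ - q'_μ) / g²`.
(On the null set `p = q`, where the collision kernel vanishes, its value is irrelevant.) -/
def scatAngle (p q : Momentum) (ω : S2) : ℝ :=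
  Real.arccos
    (lorentz (energy p - energy q) (p - q)
        (energy (postP p q ω) - energy (postQ p q ω)) (postP p q ω - postQ p q ω)
      / relMom p q ^ 2)

/-- Hard-sphere type scattering kernels: `σ(g, θ) ≈ g σ₀(θ)` with comparison constant `Λ`, where
the angular part `σ₀` is measurable and `0 ≤ σ₀ ≤ 1 / (4π)`; in particular `σ₀` is integrable
on `𝕊²` with `∫ σ₀(θ) dω ≤ 1`. -/
structure IsHardSphereKernel (Λ : ℝ) (σ : ℝ → ℝ → ℝ) (σ₀ : ℝ → ℝ) : Prop where
  measurable_sigma : Measurable (Function.uncurry σ)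
  measurable_angular : Measurable σ₀
  angular_nonneg : ∀ θ ∈ Set.Icc 0 Real.pi, 0 ≤ σ₀ θ
  angular_le : ∀ θ ∈ Set.Icc 0 Real.pi, σ₀ θ ≤ 1 / (4 * Real.pi)
  lower : ∀ g, 0 ≤ g → ∀ θ ∈ Set.Icc 0 Real.pi, Λ⁻¹ * (g * σ₀ θ) ≤ σ g θ
  upper : ∀ g, 0 ≤ g → ∀ θ ∈ Set.Icc 0 Real.pi, σ g θ ≤ Λ * (g * σ₀ θ)

/-- The gain term `Q⁺(f, h)(x₁, p) = ∫_{ℝ³} ∫_{𝕊²} v_M σ(g, θ) f(x₁, p') h(x₁, q') dω dq`, for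
non-negative `f` and `h`, as a Lebesgue integral with values in `[0, ∞]`. -/
def gain (σ : ℝ → ℝ → ℝ) (f h : unitInterval → Momentum → ℝ)
    (x : unitInterval) (p : Momentum) : ENNReal :=
  ∫⁻ q : Momentum, ∫⁻ ω : S2,
    ENNReal.ofReal (moller p q * σ (relMom p q) (scatAngle p q ω)
      * f x (postP p q ω) * h x (postQ p q ω)) ∂surfaceMeasure

/-- The weight `φ(p) = exp (k p⁰)`. -/
def weight (k : ℝ) (p : Momentum) : ℝ := Real.exp (k * energy p)

/-- `‖f‖ = ∫ ess sup_{x₁ ∈ [0, 1]} |f(x₁, p)| (p⁰)^{1/2} φ(p) dp`, with values in `[0, ∞]`. -/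
def wnorm (k : ℝ) (f : unitInterval → Momentum → ℝ) : ENNReal :=
  ∫⁻ p : Momentum, essSup (fun x : unitInterval => ENNReal.ofReal |f x p|) volume
    * ENNReal.ofReal (Real.sqrt (energy p) * weight k p)

end RelBoltzmann

end

/-!
In the center-of-momentum frame of a pair of total momentum `P`, the two momenta are `u` and `-u`,
and a collision replaces `u` by `|u| ω`. The Jacobian of the change of variables from `u` to the
laboratory momentum `p`, multiplied by the Møller velocity, depends on `u` through `|u|` only, so
polar coordinates in `u` show that `v_M dω dp dq` is invariant under the exchange of pre- and
post-collisional momenta.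

The exponential weight is absorbed by `φ(p) ≤ φ(p') φ(q')`, a consequence of energy conservation.
The exchange then moves the singularity to `1 / |p' - a|`, integrated over the sphere for fixed `p`
and `q`. As `ω` varies, `p'` runs over the image of a sphere of radius `g / 2` under a Lorentz
boost, which does not contract distances; hence that integral is `O(1 / g)` uniformly in `a`, and
the factor `g` of the hard-sphere kernel compensates it.
-/

namespace RelBoltzmann

section EssSup

variable {α β : Type*} [MeasurableSpace α] [MeasurableSpace β] {μ : Measure α} {ν : Measure β}

theorem essSup_le_iff_ae_le {f : α → ENNReal} {c : ENNReal} :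
    essSup f μ ≤ c ↔ ∀ᵐ x ∂μ, f x ≤ c :=
  ⟨fun h => (ENNReal.ae_le_essSup f).mono fun _ hx => hx.trans h, essSup_le_of_ae_le c⟩

theorem measurable_essSup_left [SFinite μ] {f : α → β → ENNReal}
    (hf : Measurable (Function.uncurry f)) : Measurable fun y => essSup (fun x => f x y) μ := by
  refine measurable_of_Iic fun c => ?_
  have h : (fun y => essSup (fun x => f x y) μ) ⁻¹' Set.Iic c =
      (fun y => μ ((fun x => (x, y)) ⁻¹' {z | c < Function.uncurry f z})) ⁻¹' {0} := by
    ext y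
    simp only [Set.mem_preimage, Set.mem_Iic, essSup_le_iff_ae_le, ae_iff, not_le]
    rfl
  rw [h]
  exact measurable_measure_prodMk_right (measurableSet_lt measurable_const hf)
    (measurableSet_singleton 0)

theorem essSup_lintegral_le [SFinite μ] [SFinite ν] {f : α → β → ENNReal}
    (hf : Measurable (Function.uncurry f)) :
    essSup (fun x => ∫⁻ y, f x y ∂ν) μ ≤ ∫⁻ y, essSup (fun x => f x y) μ ∂ν := by
  have hmeas : MeasurableSet {z : α × β | f z.1 z.2 ≤ essSup (fun x => f x z.2) μ} :=
    measurableSet_le hf ((measurable_essSup_left hf).comp measurable_snd)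
  have hle : ∀ᵐ x ∂μ, ∀ᵐ y ∂ν, f x y ≤ essSup (fun x => f x y) μ :=
    (Measure.ae_ae_comm hmeas).2 (.of_forall fun y => ENNReal.ae_le_essSup fun x => f x y)
  exact essSup_le_iff_ae_le.2 (hle.mono fun x => lintegral_mono_ae)

theorem essSup_lintegral_lintegral_le {γ : Type*} [MeasurableSpace γ] {ρ : Measure γ} [SFinite μ]
    [SFinite ν] [SFinite ρ] {f : α → β → γ → ENNReal}
    (hf : Measurable fun z : (α × β) × γ => f z.1.1 z.1.2 z.2) :
    essSup (fun x => ∫⁻ y, ∫⁻ z, f x y z ∂ρ ∂ν) μ ≤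
      ∫⁻ y, ∫⁻ z, essSup (fun x => f x y z) μ ∂ρ ∂ν := by
  refine (essSup_lintegral_le hf.lintegral_prod_right').trans (lintegral_mono fun y => ?_)
  have hy : Measurable fun w : α × γ => ((w.1, y), w.2) := by fun_prop
  exact essSup_lintegral_le (f := fun x z => f x y z) (hf.comp hy)

end EssSup

section Sphere

open scoped Pointwise
open Set

theorem lintegral_one_div_le_of_measure_lt_le {α : Type*} [MeasurableSpace α] {μ : Measure α}
    {f : α → ℝ} (hf : Measurable f) (hf0 : ∀ x, 0 ≤ f x) {s : ℝ} (hs : 1 < s) {K : ENNReal}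
    (hK : ∀ ε, 0 < ε → ε ≤ 1 → μ {x | f x < ε} ≤ K * ENNReal.ofReal (ε ^ s)) :
    ∫⁻ x, ENNReal.ofReal (1 / f x) ∂μ ≤ μ univ + K * ENNReal.ofReal (1 / (s - 1)) := by
  rw [lintegral_eq_lintegral_meas_lt _ (.of_forall fun x => one_div_nonneg.2 (hf0 x))
    (by fun_prop), ← Ioc_union_Ioi_eq_Ioi zero_le_one,
    lintegral_union measurableSet_Ioi (Ioc_disjoint_Ioi le_rfl)]
  have hsmall : ∫⁻ t in Ioc (0 : ℝ) 1, μ {x | t < 1 / f x} ≤ μ univ :=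
    (lintegral_mono fun t => measure_mono (subset_univ _)).trans (by simp)
  have hlevel : ∀ t ∈ Ioi (1 : ℝ), μ {x | t < 1 / f x} ≤ K * ENNReal.ofReal (t ^ (-s)) := by
    intro t (ht : 1 < t)
    have ht0 : 0 < t := one_pos.trans ht
    have hsub : {x | t < 1 / f x} ⊆ {x | f x < 1 / t} := fun x (hx : t < 1 / f x) =>
      (lt_one_div ht0 (one_div_pos.1 (ht0.trans hx))).1 hx
    calc μ {x | t < 1 / f x} ≤ K * ENNReal.ofReal ((1 / t) ^ s) :=
          (measure_mono hsub).trans (hK _ (one_div_pos.2 ht0) ((div_le_one ht0).2 ht.le))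
      _ = K * ENNReal.ofReal (t ^ (-s)) := by
          rw [one_div, Real.inv_rpow ht0.le, Real.rpow_neg ht0.le]
  have htail : ∫⁻ t in Ioi (1 : ℝ), ENNReal.ofReal (t ^ (-s)) = ENNReal.ofReal (1 / (s - 1)) := by
    rw [← ofReal_integral_eq_lintegral_ofReal (integrableOn_Ioi_rpow_of_lt (by linarith) one_pos)
      (by
        filter_upwards [ae_restrict_mem measurableSet_Ioi] with t ht
        exact Real.rpow_nonneg (one_pos.trans ht).le _),
      integral_Ioi_rpow_of_lt (by linarith) one_pos, Real.one_rpow, ← neg_div_neg_eq]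
    ring_nf
  refine add_le_add hsmall ((setLIntegral_mono' measurableSet_Ioi hlevel).trans_eq ?_)
  rw [lintegral_const_mul _ (by fun_prop), htail]

variable {E : Type*} [NormedAddCommGroup E] [NormedSpace ℝ E]

/-- The cone over a cap of radius `ε` lies in a `3ε`-neighbourhood of a unit segment, which is
covered by `O(1 / ε)` balls. -/
theorem exists_cone_subset_biUnion_ball {s : Set (Metric.sphere (0 : E) 1)} {b : E} {ε : ℝ}
    (hε : 0 < ε) (hs : ∀ ω ∈ s, ‖(ω : E) - b‖ < ε) :
    ∃ x : ℕ → E, Ioo (0 : ℝ) 1 • ((↑) '' s : Set E) ⊆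
      ⋃ j ∈ Finset.range (⌊1 / ε⌋₊ + 1), Metric.ball (x j) (3 * ε) := by
  rcases s.eq_empty_or_nonempty with rfl | ⟨ω₀, hω₀⟩
  · exact ⟨0, by simp⟩
  refine ⟨fun j => (j * ε) • (ω₀ : E), ?_⟩
  rintro _ ⟨t, ⟨ht0, ht1⟩, _, ⟨ω, hω, rfl⟩, rfl⟩
  have hdist : ‖(ω : E) - ω₀‖ < 2 * ε := by
    have := norm_sub_le_norm_sub_add_norm_sub (ω : E) b ω₀
    have := hs ω hω
    have := hs ω₀ hω₀
    rw [norm_sub_rev] at this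
    linarith
  have hle : ⌊t / ε⌋₊ * ε ≤ t := (le_div_iff₀ hε).1 (Nat.floor_le (by positivity))
  have hlt : t < (⌊t / ε⌋₊ + 1) * ε := (div_lt_iff₀ hε).1 (Nat.lt_floor_add_one _)
  simp only [mem_iUnion, Finset.mem_range, mem_ball_iff_norm]
  refine ⟨⌊t / ε⌋₊, Nat.lt_succ_of_le (Nat.floor_mono (by gcongr)), ?_⟩
  calc ‖t • (ω : E) - (⌊t / ε⌋₊ * ε) • (ω₀ : E)‖
      = ‖t • ((ω : E) - ω₀) + (t - ⌊t / ε⌋₊ * ε) • (ω₀ : E)‖ := by congr 1; module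
    _ ≤ t * ‖(ω : E) - ω₀‖ + (t - ⌊t / ε⌋₊ * ε) := by
        refine (norm_add_le _ _).trans_eq ?_
        rw [norm_smul, norm_smul, norm_eq_of_mem_sphere, Real.norm_of_nonneg ht0.le,
          Real.norm_of_nonneg (by linarith), mul_one]
    _ < 3 * ε := by nlinarith [norm_nonneg ((ω : E) - ω₀)]

variable [FiniteDimensional ℝ E] [MeasurableSpace E] [BorelSpace E] (μ : Measure E)
  [μ.IsAddHaarMeasure]

theorem toSphere_setOf_norm_sub_lt_le (b : E) {ε : ℝ} (hε : 0 < ε) (hε1 : ε ≤ 1) :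
    μ.toSphere {ω | ‖(ω : E) - b‖ < ε} ≤
      ENNReal.ofReal (2 / ε * (3 * ε) ^ Module.finrank ℝ E) * μ.toSphere univ := by
  obtain ⟨x, hx⟩ :=
    exists_cone_subset_biUnion_ball
      (s := {ω : Metric.sphere (0 : E) 1 | ‖(ω : E) - b‖ < ε}) hε fun _ hω => hω
  have hcard : ((⌊1 / ε⌋₊ + 1 : ℕ) : ℝ) ≤ 2 / ε := by
    have h1 : (⌊1 / ε⌋₊ : ℝ) ≤ 1 / ε := Nat.floor_le (by positivity)
    have h2 : 1 ≤ 1 / ε := (one_le_div hε).2 hε1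
    have h3 : 2 / ε = 1 / ε + 1 / ε := by ring
    push_cast
    linarith
  have hcone := calc μ (Ioo (0 : ℝ) 1 • ((↑) '' {ω : Metric.sphere (0 : E) 1 | ‖(ω : E) - b‖ < ε}))
      ≤ ∑ j ∈ Finset.range (⌊1 / ε⌋₊ + 1), μ (Metric.ball (x j) (3 * ε)) :=
        (measure_mono hx).trans (measure_biUnion_finset_le _ _)
    _ = ((⌊1 / ε⌋₊ + 1 : ℕ) : ENNReal) *
          (ENNReal.ofReal ((3 * ε) ^ Module.finrank ℝ E) * μ (Metric.ball 0 1)) := by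
        simp only [μ.addHaar_ball_of_pos _ (by positivity : 0 < 3 * ε), Finset.sum_const,
          Finset.card_range, nsmul_eq_mul]
    _ ≤ ENNReal.ofReal (2 / ε) *
          (ENNReal.ofReal ((3 * ε) ^ Module.finrank ℝ E) * μ (Metric.ball 0 1)) := by
        rw [← ENNReal.ofReal_natCast]
        gcongr
  rw [μ.toSphere_apply' (measurableSet_lt (by fun_prop) measurable_const), μ.toSphere_apply_univ,
    ENNReal.ofReal_mul (by positivity)]
  exact (mul_le_mul_right hcone _).trans_eq (by ring)

theorem lintegral_toSphere_one_div_norm_sub_le (hE : 3 ≤ Module.finrank ℝ E) (b : E) :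
    ∫⁻ ω, ENNReal.ofReal (1 / ‖(ω : E) - b‖) ∂μ.toSphere ≤
      ENNReal.ofReal (1 + 2 * 3 ^ Module.finrank ℝ E / (Module.finrank ℝ E - 2)) *
        μ.toSphere univ := by
  set n := Module.finrank ℝ E with hn
  have hn3 : (3 : ℝ) ≤ n := by exact_mod_cast hE
  have hcap : ∀ ε : ℝ, 0 < ε → ε ≤ 1 → μ.toSphere {ω | ‖(ω : E) - b‖ < ε} ≤
      ENNReal.ofReal (2 * 3 ^ n) * μ.toSphere univ * ENNReal.ofReal (ε ^ (n - 1 : ℝ)) := by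
    intro ε hε hε1
    refine (toSphere_setOf_norm_sub_lt_le μ b hε hε1).trans_eq ?_
    rw [mul_right_comm, ← ENNReal.ofReal_mul (by positivity), ← hn, Real.rpow_sub_one hε.ne',
      Real.rpow_natCast]
    congr 2
    ring
  refine (lintegral_one_div_le_of_measure_lt_le (by fun_prop) (fun _ => norm_nonneg _)
    (by linarith) hcap).trans_eq ?_
  rw [mul_right_comm, ← ENNReal.ofReal_mul (by positivity), ← one_add_mul,
    ← ENNReal.ofReal_one, ← ENNReal.ofReal_add zero_le_one]
  · congr 2; ring
  · have : 0 < (n : ℝ) - 1 - 1 := by linarith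
    positivity

theorem lintegral_eq_lintegral_toSphere_prod [Nontrivial E] (f : E → ENNReal) :
    ∫⁻ x, f x ∂μ = ∫⁻ z : Metric.sphere (0 : E) 1 × Ioi (0 : ℝ), f ((z.2 : ℝ) • (z.1 : E))
      ∂μ.toSphere.prod (Measure.volumeIoiPow (Module.finrank ℝ E - 1)) := by
  calc ∫⁻ x, f x ∂μ = ∫⁻ x : ({0}ᶜ : Set E), f x ∂μ.comap (↑) := by
        rw [lintegral_subtype_comap (measurableSet_singleton _).compl, restrict_compl_singleton]
    _ = ∫⁻ x : ({0}ᶜ : Set E), f (((homeomorphUnitSphereProd E x).2 : ℝ) •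
          ((homeomorphUnitSphereProd E x).1 : E)) ∂μ.comap (↑) :=
        lintegral_congr fun x => congrArg f <|
          congrArg Subtype.val ((homeomorphUnitSphereProd E).symm_apply_apply x).symm
    _ = _ := μ.measurePreserving_homeomorphUnitSphereProd.lintegral_comp_emb
        (Homeomorph.measurableEmbedding _) fun z => f ((z.2 : ℝ) • (z.1 : E))

/-- In polar coordinates both sides are integrals over two directions and one common radius. -/
theorem lintegral_toSphere_norm_smul_comm [Nontrivial E] {f : E → E → ENNReal}
    (hf : Measurable (Function.uncurry f)) :
    ∫⁻ x, ∫⁻ ω, f x (‖x‖ • (ω : E)) ∂μ.toSphere ∂μ =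
      ∫⁻ x, ∫⁻ ω, f (‖x‖ • (ω : E)) x ∂μ.toSphere ∂μ := by
  have hnorm (z : Metric.sphere (0 : E) 1 × Ioi (0 : ℝ)) : ‖(z.2 : ℝ) • (z.1 : E)‖ = z.2 := by
    rw [norm_smul, norm_eq_of_mem_sphere, mul_one, Real.norm_of_nonneg z.2.2.le]
  have hpolar {g : E → E → ENNReal} (hg : Measurable (Function.uncurry g)) :
      ∫⁻ x, ∫⁻ ω, g x (‖x‖ • (ω : E)) ∂μ.toSphere ∂μ =
        ∫⁻ r : Ioi (0 : ℝ), ∫⁻ ω, ∫⁻ ω', g ((r : ℝ) • (ω : E)) ((r : ℝ) • (ω' : E))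
          ∂μ.toSphere ∂μ.toSphere ∂Measure.volumeIoiPow (Module.finrank ℝ E - 1) := by
    have hpair : Measurable fun z : (Metric.sphere (0 : E) 1 × Ioi (0 : ℝ)) ×
        Metric.sphere (0 : E) 1 => ((z.1.2 : ℝ) • (z.1.1 : E), (z.1.2 : ℝ) • (z.2 : E)) := by
      fun_prop
    rw [lintegral_eq_lintegral_toSphere_prod]
    simp only [hnorm]
    exact lintegral_prod_symm' _ (hg.comp hpair).lintegral_prod_right'
  rw [hpolar hf, hpolar (g := fun x y => f y x) (hf.comp measurable_swap)]
  refine lintegral_congr fun r => ?_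
  have hpair : Measurable fun z : Metric.sphere (0 : E) 1 × Metric.sphere (0 : E) 1 =>
      ((r : ℝ) • (z.1 : E), (r : ℝ) • (z.2 : E)) := by fun_prop
  exact lintegral_lintegral_swap (hf.comp hpair).aemeasurable

end Sphere

section Boost

variable {V : Type*} [NormedAddCommGroup V]

/-- The energy of a system of invariant mass `M` and total momentum `P`. -/
noncomputable def massEnergy (M : ℝ) (P : V) : ℝ := √(M ^ 2 + ‖P‖ ^ 2)

/-- The coefficient `(γ - 1) / |P|²` with `γ = massEnergy M P / M`, in a form that is not singular
at `P = 0`. -/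
noncomputable def boostCoeff (M : ℝ) (P : V) : ℝ := 1 / (M * (massEnergy M P + M))

theorem massEnergy_sq (M : ℝ) (P : V) : massEnergy M P ^ 2 = M ^ 2 + ‖P‖ ^ 2 :=
  Real.sq_sqrt (by positivity)

variable {M : ℝ}

theorem massEnergy_pos (hM : 0 < M) (P : V) : 0 < massEnergy M P :=
  Real.sqrt_pos.2 (by positivity)

theorem boostCoeff_mul_norm_sq (hM : 0 < M) (P : V) :
    boostCoeff M P * ‖P‖ ^ 2 = massEnergy M P / M - 1 := by
  have hT := massEnergy_pos hM P
  rw [eq_sub_of_add_eq' (massEnergy_sq M P).symm, boostCoeff]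
  field_simp
  ring

theorem two_mul_boostCoeff_add_sq_mul_norm_sq (hM : 0 < M) (P : V) :
    2 * boostCoeff M P + boostCoeff M P ^ 2 * ‖P‖ ^ 2 = 1 / M ^ 2 := by
  have hT := massEnergy_pos hM P
  calc 2 * boostCoeff M P + boostCoeff M P ^ 2 * ‖P‖ ^ 2
      = boostCoeff M P * (massEnergy M P / M + 1) := by
        linear_combination boostCoeff M P * boostCoeff_mul_norm_sq hM P
    _ = 1 / M ^ 2 := by rw [boostCoeff]; field_simp

theorem hasDerivAt_massEnergy (hM : 0 < M) (P : V) :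
    HasDerivAt (fun M => massEnergy M P) (M / massEnergy M P) M := by
  refine (((hasDerivAt_pow 2 M).add_const (‖P‖ ^ 2)).sqrt (by positivity)).congr_deriv ?_
  change _ / (2 * massEnergy M P) = _
  have := massEnergy_pos hM P
  field_simp
  norm_num

theorem hasDerivAt_boostCoeff (hM : 0 < M) (P : V) :
    HasDerivAt (fun M => boostCoeff M P) (-1 / (M ^ 2 * massEnergy M P)) M := by
  have hT := massEnergy_pos hM P
  have hne : M * (massEnergy M P + M) ≠ 0 := by positivity
  simp only [boostCoeff, one_div]
  refine (((hasDerivAt_id M).mul ((hasDerivAt_massEnergy hM P).add (hasDerivAt_id M))).inv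
    hne).congr_deriv ?_
  simp only [Pi.mul_apply, Pi.add_apply, id]
  field_simp
  ring

variable [InnerProductSpace ℝ V]

/-- The spatial part `v ↦ v + (γ - 1) (P · v) P / |P|²` of the Lorentz boost out of the rest frame
of a system of invariant mass `M` and total momentum `P`. -/
noncomputable def boost (M : ℝ) (P : V) : V →L[ℝ] V :=
  ContinuousLinearMap.id ℝ V + (boostCoeff M P • innerSL ℝ P).smulRight P

theorem boost_apply (M : ℝ) (P v : V) : boost M P v = v + (boostCoeff M P * inner ℝ P v) • P := rfl

theorem inner_boost (hM : 0 < M) (P v : V) :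
    inner ℝ P (boost M P v) = massEnergy M P / M * inner ℝ P v := by
  rw [boost_apply, inner_add_right, real_inner_smul_right, real_inner_self_eq_norm_sq]
  linear_combination inner ℝ P v * boostCoeff_mul_norm_sq hM P

theorem norm_boost_sq (hM : 0 < M) (P v : V) :
    ‖boost M P v‖ ^ 2 = ‖v‖ ^ 2 + (inner ℝ P v / M) ^ 2 := by
  rw [boost_apply, norm_add_sq_real, real_inner_smul_right, norm_smul, mul_pow, Real.norm_eq_abs,
    sq_abs, real_inner_comm P v]
  linear_combination inner ℝ P v ^ 2 * two_mul_boostCoeff_add_sq_mul_norm_sq hM P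

theorem norm_le_norm_boost (hM : 0 < M) (P v : V) : ‖v‖ ≤ ‖boost M P v‖ :=
  le_of_sq_le_sq (by rw [norm_boost_sq hM]; exact le_add_of_nonneg_right (sq_nonneg _))
    (norm_nonneg _)

theorem boost_injective (hM : 0 < M) (P : V) : Function.Injective (boost M P) :=
  (injective_iff_map_eq_zero _).2 fun v hv =>
    norm_le_zero_iff.1 ((norm_le_norm_boost hM P v).trans_eq (by rw [hv, norm_zero]))

theorem boost_surjective [FiniteDimensional ℝ V] (hM : 0 < M) (P : V) :
    Function.Surjective (boost M P) :=
  (LinearMap.injective_iff_surjective (f := (boost M P : V →ₗ[ℝ] V))).1 (boost_injective hM P)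

theorem one_div_norm_boost_le (hM : 0 < M) (P v : V) : 1 / ‖boost M P v‖ ≤ 1 / ‖v‖ := by
  rcases eq_or_ne v 0 with rfl | hv
  · simp
  · exact one_div_le_one_div_of_le (norm_pos_iff.2 hv) (norm_le_norm_boost hM P v)

theorem lintegral_toSphere_div_norm_smul_boost_sub_le [FiniteDimensional ℝ V] [MeasurableSpace V]
    [BorelSpace V] (μ : Measure V) [μ.IsAddHaarMeasure] (hV : 3 ≤ Module.finrank ℝ V)
    (hM : 0 < M) (P c : V) {r : ℝ} (hr : 0 ≤ r) :
    ∫⁻ ω, ENNReal.ofReal (r / ‖r • boost M P (ω : V) - c‖) ∂μ.toSphere ≤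
      ENNReal.ofReal (1 + 2 * 3 ^ Module.finrank ℝ V / (Module.finrank ℝ V - 2)) *
        μ.toSphere Set.univ := by
  rcases hr.eq_or_lt with rfl | hr
  · simp
  obtain ⟨b, hb⟩ := boost_surjective hM P (r⁻¹ • c)
  refine le_trans (lintegral_mono fun ω => ENNReal.ofReal_le_ofReal ?_)
    (lintegral_toSphere_one_div_norm_sub_le μ hV b)
  have hsub : r • boost M P (ω : V) - c = r • boost M P (ω - b) := by
    rw [map_sub, hb, smul_sub, smul_inv_smul₀ hr.ne']
  rw [hsub, norm_smul, Real.norm_of_nonneg hr.le, div_mul_cancel_left₀ hr.ne', ← one_div]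
  exact one_div_norm_boost_le hM P _

end Boost

section Kinematics

theorem one_le_energy (p : Momentum) : 1 ≤ energy p :=
  Real.one_le_sqrt.2 (le_add_of_nonneg_right (sq_nonneg _))

theorem energy_pos (p : Momentum) : 0 < energy p := one_pos.trans_le (one_le_energy p)

theorem energy_sq (p : Momentum) : energy p ^ 2 = 1 + ‖p‖ ^ 2 := Real.sq_sqrt (by positivity)

theorem norm_lt_energy (p : Momentum) : ‖p‖ < energy p :=
  Real.lt_sqrt_of_sq_lt (by linarith)

theorem one_add_norm_mul_norm_le (p q : Momentum) : 1 + ‖p‖ * ‖q‖ ≤ energy p * energy q := by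
  have := energy_pos p
  have := energy_pos q
  refine le_of_sq_le_sq ?_ (by positivity)
  rw [mul_pow, energy_sq, energy_sq]
  nlinarith [sq_nonneg (‖p‖ - ‖q‖)]

theorem sInv_eq (p q : Momentum) : sInv p q = (energy p + energy q) ^ 2 - ‖p + q‖ ^ 2 := by
  rw [sInv, lorentz, real_inner_self_eq_norm_sq]
  ring

theorem sInv_pos (p q : Momentum) : 0 < sInv p q := by
  have hlt : ‖p + q‖ < energy p + energy q :=
    (norm_add_le p q).trans_lt (add_lt_add (norm_lt_energy p) (norm_lt_energy q))
  rw [sInv_eq]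
  nlinarith [norm_nonneg (p + q)]

theorem sInv_le (p q : Momentum) : sInv p q ≤ 4 * (energy p * energy q) := by
  have hpq : -(‖p‖ * ‖q‖) ≤ inner ℝ p q := neg_le_of_abs_le (abs_real_inner_le_norm p q)
  rw [sInv_eq, norm_add_sq_real]
  linarith [energy_sq p, energy_sq q, one_add_norm_mul_norm_le p q]

theorem relMom_eq_sqrt (p q : Momentum) : relMom p q = √(sInv p q - 4) := by
  rw [relMom, lorentz, real_inner_self_eq_norm_sq, sInv_eq, norm_add_sq_real, norm_sub_sq_real]
  congr 1
  linear_combination -2 * energy_sq p - 2 * energy_sq q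

theorem relMom_nonneg (p q : Momentum) : 0 ≤ relMom p q := Real.sqrt_nonneg _

theorem moller_nonneg (p q : Momentum) : 0 ≤ moller p q := by
  have := energy_pos p
  have := energy_pos q
  have := relMom_nonneg p q
  unfold moller
  positivity

theorem moller_le_four (p q : Momentum) : moller p q ≤ 4 := by
  have hp := energy_pos p
  have hq := energy_pos q
  have hg : relMom p q ≤ √(sInv p q) := by
    rw [relMom_eq_sqrt]
    exact Real.sqrt_le_sqrt (by linarith)
  rw [moller, div_le_iff₀ (by positivity)]
  calc relMom p q * √(sInv p q) ≤ √(sInv p q) * √(sInv p q) := by gcongr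
    _ = sInv p q := Real.mul_self_sqrt (sInv_pos p q).le
    _ ≤ 4 * (energy p * energy q) := sInv_le p q

theorem massEnergy_sqrt_sInv (p q : Momentum) :
    massEnergy √(sInv p q) (p + q) = energy p + energy q := by
  rw [massEnergy, Real.sq_sqrt (sInv_pos p q).le, sInv_eq, sub_add_cancel,
    Real.sqrt_sq (add_pos (energy_pos p) (energy_pos q)).le]

theorem cmDir_eq_boost (p q : Momentum) (ω : S2) :
    cmDir p q ω = boost √(sInv p q) (p + q) (ω : Momentum) := by
  rw [cmDir, gammaCM, ← massEnergy_sqrt_sInv,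
    ← boostCoeff_mul_norm_sq (Real.sqrt_pos.2 (sInv_pos p q)), boost_apply]
  rcases eq_or_ne (p + q) 0 with h | h
  · simp [h]
  · have := norm_ne_zero_iff.2 h
    congr 2
    field_simp

theorem postP_eq (p q : Momentum) (ω : S2) : postP p q ω =
    (1 / 2 : ℝ) • (p + q) + (relMom p q / 2) • boost √(sInv p q) (p + q) (ω : Momentum) := by
  rw [postP, cmDir_eq_boost]

theorem postQ_eq (p q : Momentum) (ω : S2) : postQ p q ω =
    (1 / 2 : ℝ) • (p + q) - (relMom p q / 2) • boost √(sInv p q) (p + q) (ω : Momentum) := by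
  rw [postQ, cmDir_eq_boost]

end Kinematics

section CenterOfMomentum

/-- The center-of-momentum energy `√s` of two particles whose momenta in that frame are `u` and
`-u`. -/
noncomputable def cmEnergy (u : Momentum) : ℝ := 2 * energy u

/-- The momentum, in the laboratory frame, of the particle that has momentum `u` in the
center-of-momentum frame of a pair of total momentum `P`. The other particle of the pair has
momentum `cmMap P (-u)`. -/
noncomputable def cmMap (P u : Momentum) : Momentum := (1 / 2 : ℝ) • P + boost (cmEnergy u) P u

/-- The Jacobian determinant of `cmMap P`. -/
noncomputable def cmJacobian (P u : Momentum) : ℝ :=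
  4 * (energy (cmMap P u) * energy (cmMap P (-u))) / (cmEnergy u * massEnergy (cmEnergy u) P)

theorem cmEnergy_pos (u : Momentum) : 0 < cmEnergy u := mul_pos two_pos (energy_pos u)

theorem cmEnergy_sq (u : Momentum) : cmEnergy u ^ 2 = 4 * (1 + ‖u‖ ^ 2) := by
  rw [cmEnergy, mul_pow, energy_sq]
  norm_num

theorem cmEnergy_congr {u v : Momentum} (h : ‖u‖ = ‖v‖) : cmEnergy u = cmEnergy v := by
  simp only [cmEnergy, energy, h]

theorem cmEnergy_neg (u : Momentum) : cmEnergy (-u) = cmEnergy u := cmEnergy_congr (norm_neg u)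

theorem cmMap_neg (P u : Momentum) :
    cmMap P (-u) = (1 / 2 : ℝ) • P - boost (cmEnergy u) P u := by
  rw [cmMap, cmEnergy_neg, map_neg, sub_eq_add_neg]

theorem cmMap_add_cmMap_neg (P u : Momentum) : cmMap P u + cmMap P (-u) = P := by
  rw [cmMap_neg, cmMap]
  module

theorem norm_cmMap_sq (P u : Momentum) : ‖cmMap P u‖ ^ 2 =
    ‖P‖ ^ 2 / 4 + massEnergy (cmEnergy u) P / cmEnergy u * inner ℝ P u +
      (‖u‖ ^ 2 + (inner ℝ P u / cmEnergy u) ^ 2) := by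
  have hE := cmEnergy_pos u
  rw [cmMap, norm_add_sq_real, norm_smul, mul_pow, real_inner_smul_left, inner_boost hE,
    norm_boost_sq hE]
  norm_num
  ring

theorem energy_cmMap (P u : Momentum) :
    energy (cmMap P u) = massEnergy (cmEnergy u) P / 2 + inner ℝ P u / cmEnergy u := by
  have hE := cmEnergy_pos u
  have hT := massEnergy_pos hE P
  have hP : ‖P‖ ≤ massEnergy (cmEnergy u) P :=
    le_of_sq_le_sq (by linarith [massEnergy_sq (cmEnergy u) P, sq_nonneg (cmEnergy u)]) hT.le
  have hu : ‖u‖ ≤ cmEnergy u / 2 := by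
    rw [cmEnergy]
    linarith [norm_lt_energy u]
  have hinner : -(massEnergy (cmEnergy u) P / 2) ≤ inner ℝ P u / cmEnergy u := by
    rw [le_div_iff₀ hE]
    calc -(massEnergy (cmEnergy u) P / 2) * cmEnergy u
        = -(massEnergy (cmEnergy u) P * (cmEnergy u / 2)) := by ring
      _ ≤ -(‖P‖ * ‖u‖) := by gcongr
      _ ≤ inner ℝ P u := neg_le_of_abs_le (abs_real_inner_le_norm P u)
  rw [energy, norm_cmMap_sq, ← Real.sqrt_sq (neg_le_iff_add_nonneg'.1 hinner)]
  congr 1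
  linear_combination (-1 / 4 : ℝ) * cmEnergy_sq u - (1 / 4 : ℝ) * massEnergy_sq (cmEnergy u) P

theorem energy_cmMap_neg (P u : Momentum) :
    energy (cmMap P (-u)) = massEnergy (cmEnergy u) P / 2 - inner ℝ P u / cmEnergy u := by
  rw [energy_cmMap, cmEnergy_neg, inner_neg_right, neg_div, sub_eq_add_neg]

theorem energy_cmMap_add_energy_cmMap_neg (P u : Momentum) :
    energy (cmMap P u) + energy (cmMap P (-u)) = massEnergy (cmEnergy u) P := by
  rw [energy_cmMap, energy_cmMap_neg]
  ring

theorem cmMap_injective (P : Momentum) : Function.Injective (cmMap P) := by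
  intro u v h
  have hneg : cmMap P (-u) = cmMap P (-v) := by
    rw [eq_sub_of_add_eq' (cmMap_add_cmMap_neg P u), h,
      ← eq_sub_of_add_eq' (cmMap_add_cmMap_neg P v)]
  have hT : massEnergy (cmEnergy u) P = massEnergy (cmEnergy v) P := by
    rw [← energy_cmMap_add_energy_cmMap_neg, h, hneg, energy_cmMap_add_energy_cmMap_neg]
  have hE : cmEnergy u = cmEnergy v := by
    refine (sq_eq_sq₀ (cmEnergy_pos u).le (cmEnergy_pos v).le).1 ?_
    rw [← add_left_inj (‖P‖ ^ 2), ← massEnergy_sq, ← massEnergy_sq, hT]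
  rw [cmMap, cmMap, hE] at h
  exact boost_injective (cmEnergy_pos v) P (add_left_cancel h)

/-- The preimage is read off the half difference `(p - q) / 2`, the boost of `u`. -/
theorem exists_cmMap_add_eq (p q : Momentum) : ∃ u, cmMap (p + q) u = p := by
  have hM := Real.sqrt_pos.2 (sInv_pos p q)
  have hT : 0 < energy p + energy q := add_pos (energy_pos p) (energy_pos q)
  obtain ⟨u, hu⟩ := boost_surjective hM (p + q) ((1 / 2 : ℝ) • (p - q))
  have hinner : inner ℝ (p + q) u / √(sInv p q) = (energy p - energy q) / 2 := by
    have h := inner_boost hM (p + q) u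
    rw [hu, massEnergy_sqrt_sInv, real_inner_smul_right, inner_add_left, inner_sub_right,
      inner_sub_right, real_inner_self_eq_norm_sq, real_inner_self_eq_norm_sq,
      real_inner_comm p q] at h
    refine mul_left_cancel₀ hT.ne' ?_
    linear_combination -h - (1 / 2 : ℝ) * energy_sq p + (1 / 2 : ℝ) * energy_sq q
  have hnorm : ‖u‖ ^ 2 = (‖p - q‖ ^ 2 - (energy p - energy q) ^ 2) / 4 := by
    have h := norm_boost_sq hM (p + q) u
    rw [hu, hinner, norm_smul, mul_pow] at h
    norm_num at h
    linarith
  have hE : cmEnergy u = √(sInv p q) := by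
    rw [← sq_eq_sq₀ (cmEnergy_pos u).le hM.le, Real.sq_sqrt (sInv_pos p q).le, cmEnergy_sq, hnorm,
      sInv_eq, norm_add_sq_real, norm_sub_sq_real]
    linear_combination -2 * energy_sq p - 2 * energy_sq q
  refine ⟨u, ?_⟩
  rw [cmMap, hE, hu]
  module

theorem cmMap_surjective (P : Momentum) : Function.Surjective (cmMap P) := fun p => by
  simpa using exists_cmMap_add_eq p (P - p)

theorem exists_eq_cmMap (p q : Momentum) : ∃ P u, p = cmMap P u ∧ q = cmMap P (-u) := by
  obtain ⟨u, hu⟩ := exists_cmMap_add_eq p q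
  refine ⟨p + q, u, hu.symm, ?_⟩
  rw [eq_sub_of_add_eq' (cmMap_add_cmMap_neg (p + q) u), hu, add_sub_cancel_left]

theorem sInv_cmMap (P u : Momentum) : sInv (cmMap P u) (cmMap P (-u)) = cmEnergy u ^ 2 := by
  rw [sInv_eq, energy_cmMap_add_energy_cmMap_neg, cmMap_add_cmMap_neg]
  exact sub_eq_of_eq_add (massEnergy_sq _ P)

theorem sqrt_sInv_cmMap (P u : Momentum) : √(sInv (cmMap P u) (cmMap P (-u))) = cmEnergy u := by
  rw [sInv_cmMap, Real.sqrt_sq (cmEnergy_pos u).le]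

theorem relMom_cmMap (P u : Momentum) : relMom (cmMap P u) (cmMap P (-u)) = 2 * ‖u‖ := by
  rw [relMom_eq_sqrt, sInv_cmMap, cmEnergy_sq, ← Real.sqrt_sq (by positivity : 0 ≤ 2 * ‖u‖)]
  ring_nf

theorem norm_norm_smul_sphere (u : Momentum) (ω : S2) : ‖‖u‖ • (ω : Momentum)‖ = ‖u‖ := by
  rw [norm_smul, norm_norm, norm_eq_of_mem_sphere, mul_one]

theorem postP_cmMap (P u : Momentum) (ω : S2) :
    postP (cmMap P u) (cmMap P (-u)) ω = cmMap P (‖u‖ • (ω : Momentum)) := by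
  rw [postP_eq, relMom_cmMap, sqrt_sInv_cmMap, cmMap_add_cmMap_neg,
    mul_div_cancel_left₀ _ two_ne_zero, cmMap, cmEnergy_congr (norm_norm_smul_sphere u ω), map_smul]

theorem postQ_cmMap (P u : Momentum) (ω : S2) :
    postQ (cmMap P u) (cmMap P (-u)) ω = cmMap P (-(‖u‖ • (ω : Momentum))) := by
  rw [postQ_eq, relMom_cmMap, sqrt_sInv_cmMap, cmMap_add_cmMap_neg,
    mul_div_cancel_left₀ _ two_ne_zero, cmMap_neg, cmEnergy_congr (norm_norm_smul_sphere u ω),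
    map_smul]

theorem energy_postP_add_energy_postQ (p q : Momentum) (ω : S2) :
    energy (postP p q ω) + energy (postQ p q ω) = energy p + energy q := by
  obtain ⟨P, u, rfl, rfl⟩ := exists_eq_cmMap p q
  rw [postP_cmMap, postQ_cmMap, energy_cmMap_add_energy_cmMap_neg,
    energy_cmMap_add_energy_cmMap_neg, cmEnergy_congr (norm_norm_smul_sphere u ω)]

theorem relMom_postP_postQ (p q : Momentum) (ω : S2) :
    relMom (postP p q ω) (postQ p q ω) = relMom p q := by
  obtain ⟨P, u, rfl, rfl⟩ := exists_eq_cmMap p q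
  rw [postP_cmMap, postQ_cmMap, relMom_cmMap, relMom_cmMap, norm_norm_smul_sphere]

theorem cmJacobian_pos (P u : Momentum) : 0 < cmJacobian P u := by
  have := cmEnergy_pos u
  have := massEnergy_pos (cmEnergy_pos u) P
  have := energy_pos (cmMap P u)
  have := energy_pos (cmMap P (-u))
  unfold cmJacobian
  positivity

/-- The right-hand side depends on `u` through `‖u‖` only: this is what makes the collision measure
invariant under the exchange of pre- and post-collisional momenta. -/
theorem cmJacobian_mul_moller (P u : Momentum) :
    cmJacobian P u * moller (cmMap P u) (cmMap P (-u)) =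
      8 * ‖u‖ / massEnergy (cmEnergy u) P := by
  have := cmEnergy_pos u
  have := massEnergy_pos (cmEnergy_pos u) P
  have := energy_pos (cmMap P u)
  have := energy_pos (cmMap P (-u))
  rw [moller, cmJacobian, relMom_cmMap, sqrt_sInv_cmMap]
  field_simp
  ring

theorem hasFDerivAt_energy (u : Momentum) :
    HasFDerivAt energy ((energy u)⁻¹ • innerSL ℝ u) u := by
  refine (((hasStrictFDerivAt_norm_sq u).hasFDerivAt.const_add 1).sqrt
    (by positivity)).congr_fderiv ?_
  change (1 / (2 * energy u)) • _ = _
  rw [← Nat.cast_smul_eq_nsmul ℝ, smul_smul]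
  congr 1
  push_cast
  field_simp

theorem hasFDerivAt_boostCoeff_cmEnergy (P u : Momentum) :
    HasFDerivAt (fun u => boostCoeff (cmEnergy u) P)
      ((-4 / (cmEnergy u ^ 3 * massEnergy (cmEnergy u) P)) • innerSL ℝ u) u := by
  have hE := cmEnergy_pos u
  have hT := massEnergy_pos hE P
  refine ((hasDerivAt_boostCoeff hE P).comp_hasFDerivAt u
    ((hasFDerivAt_energy u).const_mul 2)).congr_fderiv ?_
  rw [smul_smul, smul_smul]
  congr 1
  rw [show energy u = cmEnergy u / 2 by rw [cmEnergy]; ring]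
  field_simp
  norm_num

/-- The gradient of `u ↦ (γ - 1) (P · u) / |P|²`; the derivative of `cmMap P` is the rank-one
perturbation of the identity by this form and the vector `P`. -/
noncomputable def cmGradient (P u : Momentum) : Momentum →L[ℝ] ℝ :=
  boostCoeff (cmEnergy u) P • innerSL ℝ P +
    inner ℝ P u • (-4 / (cmEnergy u ^ 3 * massEnergy (cmEnergy u) P)) • innerSL ℝ u

theorem hasFDerivAt_cmMap (P u : Momentum) : HasFDerivAt (cmMap P)
    (ContinuousLinearMap.id ℝ Momentum + (cmGradient P u).smulRight P) u :=
  ((hasFDerivAt_id u).add (((hasFDerivAt_boostCoeff_cmEnergy P u).mul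
    (innerSL ℝ P).hasFDerivAt).smul_const P)).const_add _

theorem one_add_cmGradient (P u : Momentum) : 1 + cmGradient P u P = cmJacobian P u := by
  have hE := cmEnergy_pos u
  have hT := massEnergy_pos hE P
  have hgrad : cmGradient P u P = boostCoeff (cmEnergy u) P * ‖P‖ ^ 2 + inner ℝ P u *
      (-4 / (cmEnergy u ^ 3 * massEnergy (cmEnergy u) P) * inner ℝ P u) := by
    simp [cmGradient, real_inner_comm P u]
  rw [hgrad, boostCoeff_mul_norm_sq hE, cmJacobian, energy_cmMap, energy_cmMap_neg]
  field_simp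
  ring

theorem det_fderiv_cmMap (P u : Momentum) :
    (ContinuousLinearMap.id ℝ Momentum + (cmGradient P u).smulRight P).det = cmJacobian P u :=
  (LinearMap.transvection.det (cmGradient P u : Momentum →ₗ[ℝ] ℝ) P).trans (one_add_cmGradient P u)

theorem lintegral_eq_lintegral_cmMap (P : Momentum) (h : Momentum → ENNReal) :
    ∫⁻ p, h p = ∫⁻ u, ENNReal.ofReal (cmJacobian P u) * h (cmMap P u) := by
  have := lintegral_image_eq_lintegral_abs_det_fderiv_mul (volume : Measure Momentum)
    MeasurableSet.univ (fun u _ => (hasFDerivAt_cmMap P u).hasFDerivWithinAt)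
    (cmMap_injective P).injOn h
  simpa only [Set.image_univ, (cmMap_surjective P).range_eq, Measure.restrict_univ,
    det_fderiv_cmMap, abs_of_pos (cmJacobian_pos P _)] using this

end CenterOfMomentum

section CollisionalSwap

instance : IsFiniteMeasure surfaceMeasure := by unfold surfaceMeasure; infer_instance

theorem measurable_post : Measurable fun z : (Momentum × Momentum) × S2 =>
    (postP z.1.1 z.1.2 z.2, postQ z.1.1 z.1.2 z.2) := by
  unfold postP postQ cmDir gammaCM relMom sInv lorentz energy
  fun_prop

theorem measurable_relMom : Measurable fun z : Momentum × Momentum => relMom z.1 z.2 := by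
  unfold relMom lorentz energy
  fun_prop

theorem measurable_moller : Measurable fun z : Momentum × Momentum => moller z.1 z.2 := by
  unfold moller relMom sInv lorentz energy
  fun_prop

theorem measurable_massEnergy_cmEnergy (P : Momentum) :
    Measurable fun u => massEnergy (cmEnergy u) P := by
  unfold massEnergy cmEnergy energy
  fun_prop

theorem measurable_cmMap (P : Momentum) : Measurable (cmMap P) :=
  (continuous_iff_continuousAt.2 fun u => (hasFDerivAt_cmMap P u).continuousAt).measurable

theorem lintegral_lintegral_eq_cmMap {H : Momentum × Momentum → ENNReal} (hH : Measurable H) :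
    ∫⁻ p, ∫⁻ q, H (p, q) =
      ∫⁻ P, ∫⁻ u, ENNReal.ofReal (cmJacobian P u) * H (cmMap P u, cmMap P (-u)) := by
  have hshear : Measurable fun z : Momentum × Momentum => (z.1, z.2 - z.1) := by fun_prop
  calc ∫⁻ p, ∫⁻ q, H (p, q) = ∫⁻ p, ∫⁻ P, H (p, P - p) :=
        lintegral_congr fun p => (lintegral_sub_right_eq_self (fun q => H (p, q)) p).symm
    _ = ∫⁻ P, ∫⁻ p, H (p, P - p) := lintegral_lintegral_swap (hH.comp hshear).aemeasurable
    _ = _ := lintegral_congr fun P => by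
        simp only [lintegral_eq_lintegral_cmMap P fun p => H (p, P - p),
          ← eq_sub_of_add_eq' (cmMap_add_cmMap_neg P _)]

theorem lintegral_cmMap_swap {Φ : Momentum × Momentum → Momentum × Momentum → ENNReal}
    (hΦ : Measurable (Function.uncurry Φ)) (P : Momentum) :
    ∫⁻ u, ENNReal.ofReal (cmJacobian P u) *
        ∫⁻ ω : S2, ENNReal.ofReal (moller (cmMap P u) (cmMap P (-u))) *
          Φ (cmMap P u, cmMap P (-u)) (postP (cmMap P u) (cmMap P (-u)) ω,
            postQ (cmMap P u) (cmMap P (-u)) ω) ∂surfaceMeasure =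
      ∫⁻ u, ENNReal.ofReal (cmJacobian P u) *
        ∫⁻ ω : S2, ENNReal.ofReal (moller (cmMap P u) (cmMap P (-u))) *
          Φ (postP (cmMap P u) (cmMap P (-u)) ω, postQ (cmMap P u) (cmMap P (-u)) ω)
            (cmMap P u, cmMap P (-u)) ∂surfaceMeasure := by
  let c (u : Momentum) : ENNReal := ENNReal.ofReal (8 * ‖u‖ / massEnergy (cmEnergy u) P)
  have hc (u : Momentum) (ω : S2) : c (‖u‖ • (ω : Momentum)) = c u := by
    simp only [c, norm_norm_smul_sphere, cmEnergy_congr (norm_norm_smul_sphere u ω)]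
  have hcm := measurable_cmMap P
  have hT := measurable_massEnergy_cmEnergy P
  have hcmeas : Measurable c := by fun_prop
  have hpair : Measurable fun z : Momentum × Momentum =>
      ((cmMap P z.1, cmMap P (-z.1)), (cmMap P z.2, cmMap P (-z.2))) := by fun_prop
  have hswap : ∫⁻ u, ∫⁻ ω : S2, c u * Φ (cmMap P u, cmMap P (-u))
        (cmMap P (‖u‖ • (ω : Momentum)), cmMap P (-(‖u‖ • (ω : Momentum)))) ∂surfaceMeasure =
      ∫⁻ u, ∫⁻ ω : S2, c (‖u‖ • (ω : Momentum)) * Φ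
        (cmMap P (‖u‖ • (ω : Momentum)), cmMap P (-(‖u‖ • (ω : Momentum))))
        (cmMap P u, cmMap P (-u)) ∂surfaceMeasure :=
    lintegral_toSphere_norm_smul_comm volume
      (f := fun u v => c u * Φ (cmMap P u, cmMap P (-u)) (cmMap P v, cmMap P (-v)))
      ((hcmeas.comp measurable_fst).mul (hΦ.comp hpair))
  simp only [hc] at hswap
  simp only [← lintegral_const_mul' _ _ ENNReal.ofReal_ne_top, ← mul_assoc,
    ← ENNReal.ofReal_mul (cmJacobian_pos P _).le, cmJacobian_mul_moller, postP_cmMap, postQ_cmMap]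
  exact hswap

theorem lintegral_moller_swap {Φ : Momentum × Momentum → Momentum × Momentum → ENNReal}
    (hΦ : Measurable (Function.uncurry Φ)) :
    ∫⁻ p, ∫⁻ q, ∫⁻ ω : S2, ENNReal.ofReal (moller p q) *
        Φ (p, q) (postP p q ω, postQ p q ω) ∂surfaceMeasure =
      ∫⁻ p, ∫⁻ q, ∫⁻ ω : S2, ENNReal.ofReal (moller p q) *
        Φ (postP p q ω, postQ p q ω) (p, q) ∂surfaceMeasure := by
  have hv : Measurable fun z : (Momentum × Momentum) × S2 =>
      ENNReal.ofReal (moller z.1.1 z.1.2) :=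
    (measurable_moller.comp measurable_fst).ennreal_ofReal
  have hpre : Measurable fun z : Momentum × Momentum => ∫⁻ ω : S2, ENNReal.ofReal
      (moller z.1 z.2) * Φ z (postP z.1 z.2 ω, postQ z.1 z.2 ω) ∂surfaceMeasure :=
    (hv.mul (hΦ.comp (measurable_fst.prodMk measurable_post))).lintegral_prod_right'
  have hpost : Measurable fun z : Momentum × Momentum => ∫⁻ ω : S2, ENNReal.ofReal
      (moller z.1 z.2) * Φ (postP z.1 z.2 ω, postQ z.1 z.2 ω) z ∂surfaceMeasure :=
    (hv.mul (hΦ.comp (measurable_post.prodMk measurable_fst))).lintegral_prod_right'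
  exact (lintegral_lintegral_eq_cmMap hpre).trans
    ((lintegral_congr fun P => lintegral_cmMap_swap hΦ P).trans
      (lintegral_lintegral_eq_cmMap hpost).symm)

end CollisionalSwap

section GainEstimate

theorem surfaceMeasure_univ : surfaceMeasure Set.univ = ENNReal.ofReal (4 * Real.pi) := by
  rw [surfaceMeasure, Measure.toSphere_apply_univ, EuclideanSpace.volume_ball_fin_three,
    finrank_euclideanSpace, Fintype.card_fin, ← ENNReal.ofReal_natCast,
    ENNReal.ofReal_one, one_pow, one_mul, ← ENNReal.ofReal_mul (by positivity)]
  congr 1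
  push_cast
  ring

theorem lintegral_moller_mul_relMom_div_norm_postP_sub_le (p q a : Momentum) :
    ∫⁻ ω, ENNReal.ofReal (moller p q * (relMom p q / ‖postP p q ω - a‖)) ∂surfaceMeasure ≤
      ENNReal.ofReal (1760 * Real.pi) := by
  have hg := relMom_nonneg p q
  set c := a - (1 / 2 : ℝ) • (p + q) with hc
  set B := boost √(sInv p q) (p + q)
  have hpot : ∫⁻ ω : S2, ENNReal.ofReal (relMom p q / 2 / ‖(relMom p q / 2) • B ω - c‖)
      ∂surfaceMeasure ≤ ENNReal.ofReal 55 * surfaceMeasure Set.univ :=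
    (lintegral_toSphere_div_norm_smul_boost_sub_le volume
      (finrank_euclideanSpace_fin (𝕜 := ℝ) (n := 3)).ge (Real.sqrt_pos.2 (sInv_pos p q)) (p + q) c
      (by positivity)).trans_eq (by rw [finrank_euclideanSpace_fin]; norm_num [surfaceMeasure])
  have hpoint (ω : S2) : moller p q * (relMom p q / ‖postP p q ω - a‖) ≤
      8 * (relMom p q / 2 / ‖(relMom p q / 2) • B ω - c‖) := by
    have hsub : postP p q ω - a = (relMom p q / 2) • B ω - c := by
      rw [postP_eq, hc]
      abel
    rw [hsub]
    calc _ ≤ 4 * (relMom p q / ‖(relMom p q / 2) • B ω - c‖) := by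
          gcongr
          exact moller_le_four p q
      _ = _ := by ring
  calc ∫⁻ ω, ENNReal.ofReal (moller p q * (relMom p q / ‖postP p q ω - a‖)) ∂surfaceMeasure
      ≤ ENNReal.ofReal 8 * ∫⁻ ω : S2, ENNReal.ofReal
          (relMom p q / 2 / ‖(relMom p q / 2) • B ω - c‖) ∂surfaceMeasure := by
        simp only [← lintegral_const_mul' _ _ ENNReal.ofReal_ne_top,
          ← ENNReal.ofReal_mul (Nat.ofNat_nonneg' 8)]
        exact lintegral_mono fun ω => ENNReal.ofReal_le_ofReal (hpoint ω)
    _ ≤ ENNReal.ofReal 8 * (ENNReal.ofReal 55 * surfaceMeasure Set.univ) :=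
        mul_le_mul_right hpot _
    _ = ENNReal.ofReal (1760 * Real.pi) := by
        rw [surfaceMeasure_univ, ← ENNReal.ofReal_mul (by norm_num),
          ← ENNReal.ofReal_mul (by norm_num)]
        ring_nf

theorem lintegral_collision_le {G H : Momentum → ENNReal} (hG : Measurable G) (hH : Measurable H)
    (a : Momentum) :
    ∫⁻ p, ∫⁻ q, ∫⁻ ω, ENNReal.ofReal (moller p q) * (ENNReal.ofReal (relMom p q / ‖p - a‖) *
        (G (postP p q ω) * H (postQ p q ω))) ∂surfaceMeasure ≤
      ENNReal.ofReal (1760 * Real.pi) * ((∫⁻ p, G p) * ∫⁻ q, H q) := by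
  have hΦ : Measurable fun z : (Momentum × Momentum) × (Momentum × Momentum) =>
      ENNReal.ofReal (relMom z.1.1 z.1.2 / ‖z.1.1 - a‖) * (G z.2.1 * H z.2.2) := by
    have := measurable_relMom
    fun_prop
  have hpostP (p q : Momentum) : Measurable fun ω => postP p q ω :=
    (measurable_post.comp (measurable_prodMk_left (x := (p, q)))).fst
  calc _ = ∫⁻ p, ∫⁻ q, ∫⁻ ω, ENNReal.ofReal (moller p q) *
          (ENNReal.ofReal (relMom (postP p q ω) (postQ p q ω) / ‖postP p q ω - a‖) *
            (G p * H q)) ∂surfaceMeasure := lintegral_moller_swap (Φ := fun z w =>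
        ENNReal.ofReal (relMom z.1 z.2 / ‖z.1 - a‖) * (G w.1 * H w.2)) hΦ
    _ ≤ ∫⁻ p, ∫⁻ q, ENNReal.ofReal (1760 * Real.pi) * (G p * H q) := by
        refine lintegral_mono fun p => lintegral_mono fun q => ?_
        simp only [relMom_postP_postQ, ← mul_assoc (ENNReal.ofReal (moller p q)),
          ← ENNReal.ofReal_mul (moller_nonneg p q)]
        have := hpostP p q
        rw [lintegral_mul_const _ (by fun_prop)]
        exact mul_le_mul_left (lintegral_moller_mul_relMom_div_norm_postP_sub_le p q a) _
    _ = ENNReal.ofReal (1760 * Real.pi) * ((∫⁻ p, G p) * ∫⁻ q, H q) := by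
        simp only [lintegral_const_mul' _ _ ENNReal.ofReal_ne_top,
          lintegral_lintegral_mul hG.aemeasurable hH.aemeasurable]

/-- The norm `‖f(·, p)‖_{L^∞}` as a function of the momentum. -/
noncomputable def envelope (f : unitInterval → Momentum → ℝ) (p : Momentum) : ENNReal :=
  essSup (fun x => ENNReal.ofReal |f x p|) volume

/-- The density of `expNorm`, with the exponential weight distributed onto `envelope f`. -/
noncomputable def expEnvelope (k : ℝ) (f : unitInterval → Momentum → ℝ) (p : Momentum) : ENNReal :=
  envelope f p * ENNReal.ofReal (weight k p)

/-- The weighted norm `wnorm k f` without its factor `(p⁰)^{1/2}`. -/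
noncomputable def expNorm (k : ℝ) (f : unitInterval → Momentum → ℝ) : ENNReal :=
  ∫⁻ p, expEnvelope k f p

theorem measurable_envelope {f : unitInterval → Momentum → ℝ}
    (hf : Measurable (Function.uncurry f)) : Measurable (envelope f) :=
  measurable_essSup_left (f := fun x p => ENNReal.ofReal |f x p|) hf.abs.ennreal_ofReal

theorem weight_pos (k : ℝ) (p : Momentum) : 0 < weight k p := Real.exp_pos _

theorem measurable_expEnvelope (k : ℝ) {f : unitInterval → Momentum → ℝ}
    (hf : Measurable (Function.uncurry f)) : Measurable (expEnvelope k f) := by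
  have hw : Measurable (weight k) := by
    unfold weight energy
    fun_prop
  exact (measurable_envelope hf).mul hw.ennreal_ofReal

theorem expNorm_le_wnorm (k : ℝ) (f : unitInterval → Momentum → ℝ) : expNorm k f ≤ wnorm k f :=
  lintegral_mono fun p => mul_le_mul_right (ENNReal.ofReal_le_ofReal <|
    le_mul_of_one_le_left (weight_pos k p).le (Real.one_le_sqrt.2 (one_le_energy p))) _

theorem weight_le_mul {k : ℝ} (hk : 0 ≤ k) (p q : Momentum) (ω : S2) :
    weight k p ≤ weight k (postP p q ω) * weight k (postQ p q ω) := by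
  rw [weight, weight, weight, ← Real.exp_add, ← mul_add, energy_postP_add_energy_postQ]
  have := energy_pos q
  gcongr
  linarith

theorem IsHardSphereKernel.le_mul {Λ : ℝ} {σ : ℝ → ℝ → ℝ} {σ₀ : ℝ → ℝ}
    (hσ : IsHardSphereKernel Λ σ σ₀) (hΛ : 0 ≤ Λ) {g : ℝ} (hg : 0 ≤ g) {θ : ℝ}
    (hθ : θ ∈ Set.Icc 0 Real.pi) : σ g θ ≤ Λ / (4 * Real.pi) * g :=
  calc σ g θ ≤ Λ * (g * σ₀ θ) := hσ.upper g hg θ hθ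
    _ ≤ Λ * (g * (1 / (4 * Real.pi))) := by
        have := hσ.angular_le θ hθ
        gcongr
    _ = Λ / (4 * Real.pi) * g := by ring

variable {M : ℝ} {σ : ℝ → ℝ → ℝ} {f h : unitInterval → Momentum → ℝ}

theorem gain_le (hσ : ∀ g, 0 ≤ g → ∀ θ ∈ Set.Icc 0 Real.pi, σ g θ ≤ M * g)
    (hf0 : ∀ x p, 0 ≤ f x p) (hh0 : ∀ x p, 0 ≤ h x p) (x : unitInterval) (p : Momentum) :
    gain σ f h x p ≤ ENNReal.ofReal M * ∫⁻ q, ∫⁻ ω, ENNReal.ofReal (moller p q * relMom p q) *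
      (ENNReal.ofReal |f x (postP p q ω)| * ENNReal.ofReal |h x (postQ p q ω)|)
        ∂surfaceMeasure := by
  simp only [gain, ← lintegral_const_mul' _ _ ENNReal.ofReal_ne_top]
  refine lintegral_mono fun q => lintegral_mono fun ω => ?_
  have hv := moller_nonneg p q
  have hg := relMom_nonneg p q
  have hf := hf0 x (postP p q ω)
  have hh := hh0 x (postQ p q ω)
  have hσg : σ (relMom p q) (scatAngle p q ω) ≤ M * relMom p q :=
    hσ _ hg _ ⟨Real.arccos_nonneg _, Real.arccos_le_pi _⟩
  rw [abs_of_nonneg hf, abs_of_nonneg hh, ← ENNReal.ofReal_mul hf,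
    ← ENNReal.ofReal_mul (by positivity), ← ENNReal.ofReal_mul' (by positivity)]
  refine ENNReal.ofReal_le_ofReal ?_
  calc _ ≤ moller p q * (M * relMom p q) * f x (postP p q ω) * h x (postQ p q ω) := by gcongr
    _ = _ := by ring

theorem essSup_gain_le (hσ : ∀ g, 0 ≤ g → ∀ θ ∈ Set.Icc 0 Real.pi, σ g θ ≤ M * g)
    (hf : Measurable (Function.uncurry f)) (hf0 : ∀ x p, 0 ≤ f x p)
    (hh : Measurable (Function.uncurry h)) (hh0 : ∀ x p, 0 ≤ h x p) (p : Momentum) :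
    essSup (fun x => gain σ f h x p) volume ≤ ENNReal.ofReal M * ∫⁻ q, ∫⁻ ω,
      ENNReal.ofReal (moller p q * relMom p q) *
        (envelope f (postP p q ω) * envelope h (postQ p q ω)) ∂surfaceMeasure := by
  let F (x : unitInterval) (q : Momentum) (ω : S2) : ENNReal :=
    ENNReal.ofReal (moller p q * relMom p q) *
      (ENNReal.ofReal |f x (postP p q ω)| * ENNReal.ofReal |h x (postQ p q ω)|)
  have hF : Measurable fun z : (unitInterval × Momentum) × S2 => F z.1.1 z.1.2 z.2 := by
    have hpair : Measurable fun z : (unitInterval × Momentum) × S2 => (p, z.1.2) := by fun_prop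
    have hpost := measurable_post.comp (hpair.prodMk measurable_snd)
    have hx : Measurable fun z : (unitInterval × Momentum) × S2 => z.1.1 := by fun_prop
    exact ((measurable_moller.comp hpair).mul (measurable_relMom.comp hpair)).ennreal_ofReal.mul
      ((hf.comp (hx.prodMk hpost.fst)).abs.ennreal_ofReal.mul
        (hh.comp (hx.prodMk hpost.snd)).abs.ennreal_ofReal)
  calc essSup (fun x => gain σ f h x p) volume
      ≤ essSup (fun x => ENNReal.ofReal M * ∫⁻ q, ∫⁻ ω, F x q ω ∂surfaceMeasure) volume :=
        essSup_mono_ae (.of_forall fun x => gain_le hσ hf0 hh0 x p)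
    _ = ENNReal.ofReal M * essSup (fun x => ∫⁻ q, ∫⁻ ω, F x q ω ∂surfaceMeasure) volume :=
        ENNReal.essSup_const_mul
    _ ≤ ENNReal.ofReal M * ∫⁻ q, ∫⁻ ω, essSup (fun x => F x q ω) volume ∂surfaceMeasure :=
        mul_le_mul_right (essSup_lintegral_lintegral_le hF) _
    _ ≤ _ := by
        refine mul_le_mul_right (lintegral_mono fun q => lintegral_mono fun ω => ?_) _
        exact ENNReal.essSup_const_mul.trans_le (mul_le_mul_right (ENNReal.essSup_mul_le _ _) _)

theorem weight_mul_essSup_gain_le {k : ℝ} (hk : 0 ≤ k)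
    (hσ : ∀ g, 0 ≤ g → ∀ θ ∈ Set.Icc 0 Real.pi, σ g θ ≤ M * g)
    (hf : Measurable (Function.uncurry f)) (hf0 : ∀ x p, 0 ≤ f x p)
    (hh : Measurable (Function.uncurry h)) (hh0 : ∀ x p, 0 ≤ h x p) (a p : Momentum) :
    ENNReal.ofReal (weight k p / ‖p - a‖) * essSup (fun x => gain σ f h x p) volume ≤
      ENNReal.ofReal M * ∫⁻ q, ∫⁻ ω, ENNReal.ofReal (moller p q) *
        (ENNReal.ofReal (relMom p q / ‖p - a‖) *
          (expEnvelope k f (postP p q ω) * expEnvelope k h (postQ p q ω))) ∂surfaceMeasure := by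
  refine (mul_le_mul_right (essSup_gain_le hσ hf hf0 hh hh0 p) _).trans ?_
  rw [mul_left_comm]
  refine mul_le_mul_right ?_ _
  simp only [← lintegral_const_mul' _ _ ENNReal.ofReal_ne_top]
  refine lintegral_mono fun q => lintegral_mono fun ω => ?_
  have hv := moller_nonneg p q
  have hg := relMom_nonneg p q
  have hw := weight_pos k
  have hweight : ENNReal.ofReal (weight k p / ‖p - a‖) * ENNReal.ofReal (moller p q * relMom p q) ≤
      ENNReal.ofReal (moller p q) * (ENNReal.ofReal (relMom p q / ‖p - a‖) *
        (ENNReal.ofReal (weight k (postP p q ω)) * ENNReal.ofReal (weight k (postQ p q ω)))) := by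
    rw [← ENNReal.ofReal_mul (by have := hw p; positivity), ← ENNReal.ofReal_mul (hw _).le,
      ← ENNReal.ofReal_mul (by positivity), ← ENNReal.ofReal_mul hv]
    refine ENNReal.ofReal_le_ofReal ?_
    calc weight k p / ‖p - a‖ * (moller p q * relMom p q)
        = moller p q * (relMom p q / ‖p - a‖ * weight k p) := by ring
      _ ≤ _ := by
        gcongr
        exact weight_le_mul hk p q ω
  rw [← mul_assoc]
  refine (mul_le_mul_left hweight _).trans_eq ?_
  simp only [expEnvelope]
  ring

end GainEstimate

end RelBoltzmann

open RelBoltzmann in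
theorem proposition3p1_general {M k : ℝ} (hk : 0 ≤ k) {σ : ℝ → ℝ → ℝ}
    (hσ : ∀ g, 0 ≤ g → ∀ θ ∈ Set.Icc 0 Real.pi, σ g θ ≤ M * g)
    {f h : unitInterval → Momentum → ℝ}
    (hf : Measurable (Function.uncurry f)) (hf0 : ∀ x p, 0 ≤ f x p)
    (hh : Measurable (Function.uncurry h)) (hh0 : ∀ x p, 0 ≤ h x p) (a : Momentum) :
    ∫⁻ p, ENNReal.ofReal (weight k p / ‖p - a‖) * essSup (fun x => gain σ f h x p) volume ≤
      ENNReal.ofReal (M * (1760 * Real.pi)) * (expNorm k f * expNorm k h) := by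
  refine (lintegral_mono fun p => weight_mul_essSup_gain_le hk hσ hf hf0 hh hh0 a p).trans ?_
  rw [lintegral_const_mul' _ _ ENNReal.ofReal_ne_top, ENNReal.ofReal_mul' (by positivity),
    mul_assoc]
  exact mul_le_mul_right
    (lintegral_collision_le (measurable_expEnvelope k hf) (measurable_expEnvelope k hh) a) _

/-- The constant depends on the comparison constant `Λ` in `σ ≈ g σ₀` only: it is uniform in
`σ`, `σ₀`, `k`, `f` and `a`. -/
theorem proposition3p1 (Λ : ℝ) (hΛ : 1 ≤ Λ) :
    ∃ C : ℝ, 0 < C ∧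
      ∀ (σ : ℝ → ℝ → ℝ) (σ₀ : ℝ → ℝ), RelBoltzmann.IsHardSphereKernel Λ σ σ₀ →
      ∀ k : ℝ, 0 < k →
      ∀ f : unitInterval → RelBoltzmann.Momentum → ℝ,
        Measurable (Function.uncurry f) → (∀ x p, 0 ≤ f x p) →
      ∀ a : RelBoltzmann.Momentum,
        ∫⁻ p : RelBoltzmann.Momentum,
            ENNReal.ofReal (RelBoltzmann.weight k p / ‖p - a‖)
              * essSup (fun x : unitInterval => RelBoltzmann.gain σ f f x p) volume
          ≤ ENNReal.ofReal C * RelBoltzmann.wnorm k f ^ 2 := by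
  refine ⟨Λ / (4 * Real.pi) * (1760 * Real.pi), by positivity, ?_⟩
  intro σ σ₀ hσ k hk f hf hf0 a
  have hΛ0 : 0 ≤ Λ := zero_le_one.trans hΛ
  refine (proposition3p1_general hk.le (fun g hg θ hθ => hσ.le_mul hΛ0 hg hθ)
    hf hf0 hf hf0 a).trans ?_
  rw [sq]
  gcongr <;> exact RelBoltzmann.expNorm_le_wnorm k f
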